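/- **Key Lemma (probabilistic transformers memorize empirical Markov kernels).** *Definitions.* A ReLU network $\mathbb{R}^m\to\mathbb{R}^q$ of depth $J\ge 1$ with layer dimensions $d_0=m,d_1,\dots,d_J=q$ is a composition of $J$ affine maps $x\mapsto A^{(j)}x+b^{(j)}$, where $A^{(j)}\in\mathbb{R}^{d_j\times d_{j-1}}$ and $b^{(j)}\in\mathbb{R}^{d_j}$, with $t\mapsto\max\{0,t\}$ applied componentwise after every affine map except the last. Its number of parameters $\mathrm{par}$ is the number of nonzero entries of all the $A^{(j)}$ and $b^{(j)}$. Its width is the largest of its layer dimensions, input and output included; for a network with output in $\mathbb{R}^d\times\mathbb{R}^{d\times d}$, the two output vectors (of dimensions $d$ and $d^2$) are counted separately, i.e. the width is $\max\{d_0,\dots,d_{J-1},d,d^2\}$. A probabilistic transformer on a metric space $(\mathcal{X},\rho)$ with values in probability measures on $\mathbb{R}^d$ is a map $$T(x)=\sum_{k=1}^{K'}\frac{e^{w_k(x)}}{\sum_{i=1}^{K'}e^{w_i(x)}}\;N_d\big(m_k(x),S_k(x)^\top S_k(x)\big),$$ $$w(x)=\mathcal{NN}_w(u),\qquad (m_k(x),S_k(x))=\mathcal{NN}_k(u),\qquad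 u=(\rho(x,x_l))_{l=1}^{L},$$ given by integers $L,K'\ge1$, landmarks $x_1,\dots,x_L\in\mathcal{X}$, a ReLU network $\mathcal{NN}_w:\mathbb{R}^L\to\mathbb{R}^{K'}$ and ReLU networks $\mathcal{NN}_1,\dots,\mathcal{NN}_{K'}:\mathbb{R}^L\to\mathbb{R}^d\times\mathbb{R}^{d\times d}$. Here $N_d(m,\Sigma)$ is the Gaussian measure on $\mathbb{R}^d$ with mean $m$ and covariance $\Sigma$, so $N_d(m,0)$ is the point mass at $m$. The depth and the width of $T$ are the maxima of the depths and of the widths of $\mathcal{NN}_w,\mathcal{NN}_1,\dots,\mathcal{NN}_{K'}$; moreover $\mathrm{par}(T)=\mathrm{par}(\mathcal{NN}_w)+\sum_{k}\mathrm{par}(\mathcal{NN}_k)$ and $\mathrm{effdim}(T)=K'(d+d^2)$. For a finite metric space $\mathcal{X}_n$, $\operatorname{aspect}(\mathcal{X}_n)$ is the maximal distance between two points divided by the minimal distance between two distinct points. Let $(u)_+=\max\{u,1\}$ and $$C_n=\frac{2\log(5\sqrt{2\pi})+\frac32\log n-\frac12\log(n+1)}{2\log 2},$$ $$F(\mathcal{X}_n)=\sqrt{n\log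 n}\left[1+\frac{\log 2}{\log n}\left(C_n+\frac{\log\big(n^{5/2}\operatorname{aspect}(\mathcal{X}_n)\big)}{\log 2}\right)_+\right].$$ *Statement.* There is an absolute constant $C>0$ such that the following holds. Let $n>2$, $d\ge1$, $K\ge1$ be integers, let $\mathcal{X}_n$ be an $n$-point metric space, let $\mu_1,\dots,\mu_K:\mathcal{X}_n\to\mathbb{R}^d$ be arbitrary maps, and put $$\varphi(x)=\frac1K\sum_{k=1}^K N_d(\mu_k(x),0).$$ Then there is a probabilistic transformer $T$ on $\mathcal{X}_n$ with values in probability measures on $\mathbb{R}^d$ such that $T(x)=\varphi(x)$ for every $x\in\mathcal{X}_n$ and $$\mathrm{width}(T)=\max\{n,\;K,\;d^2,\;n(n-1)+\max\{d,12\}\},$$ $$\mathrm{depth}(T)\le C\,n\,\{1+F(\mathcal{X}_n)\},$$ $$\mathrm{effdim}(T)\le K(d+d^2),$$ $$\mathrm{par}(T)\le C\,K\,n\left(\tfrac{11}{4}\max\{n,d\}\,n^2-1\right)\left\{d+\max\{d,12\}^2\,F(\mathcal{X}_n)\right\}.$$ -/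

import Mathlib

open MeasureTheory ProbabilityTheory
open scoped ENNReal Matrix

noncomputable section

/-- The rectified linear unit. -/
def relu (t : ℝ) : ℝ := max 0 t

/-- The parameters of a deep feedforward ReLU network with input space `ℝ^m` and output space `ℝ^ι`:
a finite nonempty sequence of affine layers, with the componentwise ReLU applied after every layer
except the last one. -/
inductive ReLUNet (ι : Type) : ℕ → Type
  | last {m : ℕ} (A : Matrix ι (Fin m) ℝ) (b : ι → ℝ) : ReLUNet ι m
  | layer {m h : ℕ} (A : Matrix (Fin h) (Fin m) ℝ) (b : Fin h → ℝ) (next : ReLUNet ι h) :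
      ReLUNet ι m

namespace ReLUNet

variable {ι : Type}

/-- The function realized by a network. -/
def eval : {m : ℕ} → ReLUNet ι m → (Fin m → ℝ) → (ι → ℝ)
  | _, last A b, x => A *ᵥ x + b
  | _, layer A b next, x => next.eval (fun i => relu ((A *ᵥ x + b) i))

/-- The depth: the number `J` of affine layers. -/
def depth : {m : ℕ} → ReLUNet ι m → ℕ
  | _, last _ _ => 1
  | _, layer _ _ next => next.depth + 1

/-- The largest of the dimensions `d_0, …, d_{J-1}` of the input layer and of the hidden layers. -/
def innerWidth : {m : ℕ} → ReLUNet ι m → ℕ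
  | m, last _ _ => m
  | m, layer _ _ next => max m next.innerWidth

/-- The number of nonzero entries of a weight matrix. -/
def matrixNonzeros {α β : Type} (A : Matrix α β ℝ) : ℕ :=
  {p : α × β | A p.1 p.2 ≠ 0}.ncard

/-- The number of nonzero entries of a bias vector. -/
def vectorNonzeros {α : Type} (b : α → ℝ) : ℕ :=
  {i : α | b i ≠ 0}.ncard

/-- The number of trainable parameters: the nonzero entries of all weights and biases. -/
def par : {m : ℕ} → ReLUNet ι m → ℕ
  | _, last A b => matrixNonzeros A + vectorNonzeros b
  | _, layer A b next => matrixNonzeros A + vectorNonzeros b + next.par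

end ReLUNet

/-- The softmax function on `ℝ^K`. -/
def softmax {K : ℕ} (w : Fin K → ℝ) (k : Fin K) : ℝ :=
  Real.exp (w k) / ∑ i, Real.exp (w i)

/-- The Gaussian probabilistic attention mechanism
`∑ k, softmax(w)_k N(m_k, S_kᵀ S_k)`, as a measure on `ℝ^D`. -/
def probAttention {K D : ℕ} (w : Fin K → ℝ) (m : Fin K → EuclideanSpace ℝ (Fin D))
    (S : Fin K → Matrix (Fin D) (Fin D) ℝ) : Measure (EuclideanSpace ℝ (Fin D)) :=
  ∑ k, ENNReal.ofReal (softmax w k) • multivariateGaussian (m k) ((S k)ᵀ * S k)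

/-- A probabilistic transformer on the metric space `X`, with values in measures on `ℝ^D`. The
outputs of the networks `gaussNet k` lie in `ℝ^D × ℝ^{D×D}`: the coordinates `Sum.inl i` form the
mean vector and the coordinates `Sum.inr (i, j)` form the square root of the covariance matrix. -/
structure ProbTransformer (X : Type*) [MetricSpace X] (D : ℕ) where
  /-- the number of landmarks -/
  L : ℕ
  L_pos : 0 < L
  /-- the number of mixture components -/
  K : ℕ
  K_pos : 0 < K
  landmark : Fin L → X
  weightNet : ReLUNet (Fin K) L
  gaussNet : Fin K → ReLUNet (Fin D ⊕ Fin D × Fin D) L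

namespace ProbTransformer

variable {X : Type*} [MetricSpace X] {D : ℕ}

/-- The un-normalized graph attention layer: the vector of distances to the landmarks. -/
def feature (T : ProbTransformer X D) (x : X) : Fin T.L → ℝ :=
  fun l => dist x (T.landmark l)

/-- The measure-valued map realized by a probabilistic transformer. -/
def eval (T : ProbTransformer X D) (x : X) : Measure (EuclideanSpace ℝ (Fin D)) :=
  probAttention (T.weightNet.eval (T.feature x))
    (fun k => WithLp.toLp 2 fun i => (T.gaussNet k).eval (T.feature x) (Sum.inl i))
    (fun k => Matrix.of fun i j => (T.gaussNet k).eval (T.feature x) (Sum.inr (i, j)))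

/-- The depth: the maximum of the depths of the constituent networks. -/
def depth (T : ProbTransformer X D) : ℕ :=
  max T.weightNet.depth (Finset.univ.sup fun k => (T.gaussNet k).depth)

/-- The width: the maximum of the widths of the constituent networks, the width of a network being
the largest dimension of its layers, input and output included. The output in `ℝ^D × ℝ^{D×D}` of
`gaussNet k` consists of two output vectors, of dimensions `D` and `D ^ 2`, each of which is
counted on its own. -/
def width (T : ProbTransformer X D) : ℕ :=
  max (max T.weightNet.innerWidth T.K)
    (Finset.univ.sup fun k => max (T.gaussNet k).innerWidth (max D (D ^ 2)))

/-- The effective dimension `K (D + D²)`. -/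
def effdim (T : ProbTransformer X D) : ℕ := T.K * (D + D ^ 2)

/-- The number of trainable parameters of all constituent networks. -/
def par (T : ProbTransformer X D) : ℕ :=
  T.weightNet.par + ∑ k, (T.gaussNet k).par

end ProbTransformer

/-- The aspect ratio of a finite metric space: the largest distance between two points over the
smallest distance between two distinct points. -/
def aspect (X : Type*) [MetricSpace X] : ℝ :=
  Metric.diam (Set.univ : Set X) / Set.infsep (Set.univ : Set X)

/-- The map `x ↦ (1/K) ∑ k, N_d(μ_k(x), 0)`. -/
def empiricalKernel {X : Type*} {d K : ℕ} (μ : Fin K → X → EuclideanSpace ℝ (Fin d)) (x : X) :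
    Measure (EuclideanSpace ℝ (Fin d)) :=
  (K : ℝ≥0∞)⁻¹ • ∑ k, multivariateGaussian (μ k x) 0

/-- The constant `C_n`. -/
def dimConst (n : ℕ) : ℝ :=
  (2 * Real.log (5 * √(2 * Real.pi)) + 3 / 2 * Real.log n - 1 / 2 * Real.log (n + 1)) /
    (2 * Real.log 2)

/-- The quantity
`√(n log n) [1 + (log 2 / log n) (C_n + log (n^{5/2} a) / log 2)_+]`, where `(u)_+ = max {u, 1}`. -/
def complexityFactor (n : ℕ) (a : ℝ) : ℝ :=
  √(n * Real.log n) *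
    (1 + Real.log 2 / Real.log n *
      max (dimConst n + Real.log ((n : ℝ) ^ (5 / 2 : ℝ) * a) / Real.log 2) 1)

end

/-! Place a landmark at every point of the finite space, and let `δ` be the smallest distance
between two distinct points. One hidden layer of bumps `t ↦ relu (1 - t / δ)` turns the vector of
distances from `x` to the landmarks into the indicator vector of `x`, from which one affine layer
reads off an arbitrary function of `x`. So every kernel of Gaussian mixtures is realized by networks
of depth two, and idle hidden neurons adjust the width. -/

namespace ReLUNet

variable {ι α β : Type}

theorem matrixNonzeros_of_eq_sum [Fintype α] [Finite β] (A : α → β → ℝ) :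
    matrixNonzeros (Matrix.of A) = ∑ i, vectorNonzeros (A i) := by
  have := Fintype.ofFinite β
  classical
  simp only [matrixNonzeros, vectorNonzeros, Matrix.of_apply, Set.ncard_eq_toFinset_card',
    Set.toFinset_ofPred, Finset.card_filter, Fintype.sum_prod_type]

theorem matrixNonzeros_transpose (A : Matrix α β ℝ) : matrixNonzeros Aᵀ = matrixNonzeros A :=
  Set.ncard_congr' ((Equiv.prodComm β α).subtypeEquiv fun _ => Iff.rfl)

theorem vectorNonzeros_zero : vectorNonzeros (0 : α → ℝ) = 0 := by
  simp [vectorNonzeros]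

theorem vectorNonzeros_le_card [Fintype α] (b : α → ℝ) : vectorNonzeros b ≤ Fintype.card α :=
  (Set.ncard_le_card _).trans_eq Nat.card_eq_fintype_card

theorem vectorNonzeros_single_le_one [DecidableEq α] (i : α) (c : ℝ) :
    vectorNonzeros (Pi.single i c) ≤ 1 :=
  (Set.ncard_le_ncard Pi.support_single_subset).trans_eq (Set.ncard_singleton i)

theorem vectorNonzeros_append {m n : ℕ} (u : Fin m → ℝ) (v : Fin n → ℝ) :
    vectorNonzeros (Fin.append u v) = vectorNonzeros u + vectorNonzeros v := by
  simp only [vectorNonzeros, Set.ncard_eq_toFinset_card', Set.toFinset_ofPred, Finset.card_filter,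
    Fin.sum_univ_add, Fin.append_left, Fin.append_right]

theorem matrixNonzeros_append_zero {n : ℕ} [Finite β] (p : ℕ) (A : Fin n → β → ℝ) :
    matrixNonzeros (Matrix.of (Fin.append A (0 : Fin p → β → ℝ))) =
      matrixNonzeros (Matrix.of A) := by
  simp [matrixNonzeros_of_eq_sum, Fin.sum_univ_add, vectorNonzeros_zero]

theorem matrixNonzeros_of_single_le [Fintype α] [DecidableEq α] (c : ℝ) :
    matrixNonzeros (Matrix.of fun i : α => Pi.single i c) ≤ Fintype.card α := by
  simpa [matrixNonzeros_of_eq_sum] using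
    Finset.sum_le_card_nsmul Finset.univ _ 1 fun (i : α) _ => vectorNonzeros_single_le_one i c

theorem matrixNonzeros_le_card [Fintype α] [Fintype β] (A : Matrix α β ℝ) :
    matrixNonzeros A ≤ Fintype.card α * Fintype.card β :=
  (Set.ncard_le_card _).trans_eq (by simp)

/-- The network with one hidden layer, consisting of the `n` neurons `t ↦ relu (1 - t l / δ)` and of
`p` idle neurons, whose output is the combination of the vectors `y l` with the activations of the
former as coefficients. The idle neurons serve to attain a prescribed width. -/
noncomputable def memorizer {n : ℕ} (p : ℕ) (δ : ℝ) (y : Fin n → ι → ℝ) : ReLUNet ι n :=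
  .layer (Matrix.of (Fin.append (fun l => Pi.single l (-δ⁻¹)) (0 : Fin p → Fin n → ℝ)))
    (Fin.append 1 0) (.last (Matrix.of (Fin.append y (0 : Fin p → ι → ℝ)))ᵀ 0)

section memorizer

variable {n : ℕ} (p : ℕ) (δ : ℝ) (y : Fin n → ι → ℝ)

theorem eval_memorizer (t : Fin n → ℝ) :
    (memorizer p δ y).eval t = ∑ l, relu (1 - t l / δ) • y l := by
  have hbump (l : Fin n) : -(t l * δ⁻¹) + 1 = 1 - t l / δ := by ring
  funext j
  simp [memorizer, eval, Matrix.mulVec, Matrix.transpose, Fin.sum_univ_add, dotProduct, hbump,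
    Pi.single_apply, mul_comm]

theorem innerWidth_memorizer : (memorizer p δ y).innerWidth = n + p :=
  max_eq_right (Nat.le_add_right n p)

theorem par_memorizer_le [Fintype ι] : (memorizer p δ y).par ≤ n * (2 + Fintype.card ι) := by
  have hweight := matrixNonzeros_of_single_le (α := Fin n) (-δ⁻¹)
  have hbias := vectorNonzeros_le_card (1 : Fin n → ℝ)
  have hreadout := matrixNonzeros_le_card (Matrix.of y)
  rw [Fintype.card_fin] at hweight hbias hreadout
  simp only [memorizer, par, matrixNonzeros_transpose, matrixNonzeros_append_zero,
    vectorNonzeros_append, vectorNonzeros_zero]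
  linarith

end memorizer

end ReLUNet

theorem relu_one_sub_dist_div_infsep {X : Type*} [MetricSpace X] [Finite X] [DecidableEq X]
    (x y : X) :
    relu (1 - dist x y / (Set.univ : Set X).infsep) = if x = y then 1 else 0 := by
  split_ifs with hxy
  · simp [relu, hxy]
  · have hsep : 0 < (Set.univ : Set X).infsep :=
      Set.finite_univ.infsep_pos_iff_nontrivial.2 ⟨x, trivial, y, trivial, hxy⟩
    have hdist : (Set.univ : Set X).infsep ≤ dist x y :=
      Set.infsep_le_dist_of_mem trivial trivial hxy
    exact max_eq_left (sub_nonpos.2 ((one_le_div hsep).2 hdist))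

section distMemorizer

variable {X : Type*} [MetricSpace X] [Fintype X] {ι : Type}

/-- The memorizer of a function `f` on a finite metric space, to be applied to the vector of
distances to the points of the space. -/
noncomputable def ReLUNet.distMemorizer (p : ℕ) (f : X → ι → ℝ) : ReLUNet ι (Fintype.card X) :=
  memorizer p (Set.univ : Set X).infsep (f ∘ (Fintype.equivFin X).symm)

theorem ReLUNet.eval_distMemorizer (p : ℕ) (f : X → ι → ℝ) (x : X) :
    (distMemorizer p f).eval (fun l => dist x ((Fintype.equivFin X).symm l)) = f x := by
  classical
  simp only [distMemorizer, eval_memorizer, relu_one_sub_dist_div_infsep, Function.comp_apply]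
  rw [(Fintype.equivFin X).symm.sum_comp fun z => (if x = z then (1 : ℝ) else 0) • f z]
  simp

end distMemorizer

namespace ProbTransformer

variable {X : Type*} [MetricSpace X] [Fintype X] [Nonempty X] {d K : ℕ} [NeZero K]

/-- The probabilistic transformer whose landmarks are all the points of a finite space and whose
networks memorize the weights `w`, the means `m` and the square roots `S` of the covariances of a
family of Gaussian mixtures; each network has `p` idle hidden neurons. -/
noncomputable def memorizing (p : ℕ) (w : X → Fin K → ℝ)
    (m : Fin K → X → EuclideanSpace ℝ (Fin d)) (S : Fin K → X → Matrix (Fin d) (Fin d) ℝ) :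
    ProbTransformer X d where
  L := Fintype.card X
  L_pos := Fintype.card_pos
  K := K
  K_pos := NeZero.pos K
  landmark := (Fintype.equivFin X).symm
  weightNet := .distMemorizer p w
  gaussNet k := .distMemorizer p fun x => Sum.elim (m k x) (Function.uncurry (S k x))

variable (p : ℕ) (w : X → Fin K → ℝ) (m : Fin K → X → EuclideanSpace ℝ (Fin d))
  (S : Fin K → X → Matrix (Fin d) (Fin d) ℝ)

theorem eval_memorizing (x : X) :
    (memorizing p w m S).eval x = probAttention (w x) (fun k => m k x) (fun k => S k x) := by
  have hgauss (k : Fin K) := ReLUNet.eval_distMemorizer p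
    (fun x => Sum.elim (m k x) (Function.uncurry (S k x))) x
  calc (memorizing p w m S).eval x
      = probAttention (w x)
          (fun k => WithLp.toLp 2 fun i => Sum.elim (m k x) (Function.uncurry (S k x)) (.inl i))
          (fun k => Matrix.of fun i j =>
            Sum.elim (m k x) (Function.uncurry (S k x)) (.inr (i, j))) := by
        simp only [← hgauss, ← ReLUNet.eval_distMemorizer p w x]
        rfl
    _ = probAttention (w x) (fun k => m k x) (fun k => S k x) := rfl

theorem depth_memorizing : (memorizing p w m S).depth = 2 :=
  max_eq_left (Finset.sup_le fun _ _ => le_rfl)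

theorem width_memorizing :
    (memorizing p w m S).width = max K (max (d ^ 2) (Fintype.card X + p)) := by
  have hweight : (memorizing p w m S).weightNet.innerWidth = Fintype.card X + p :=
    ReLUNet.innerWidth_memorizer ..
  have hgauss (k : Fin K) :
      ((memorizing p w m S).gaussNet k).innerWidth = Fintype.card X + p :=
    ReLUNet.innerWidth_memorizer ..
  have hsup : (Finset.univ.sup fun k : Fin K =>
      max ((memorizing p w m S).gaussNet k).innerWidth (max d (d ^ 2))) =
        max (Fintype.card X + p) (d ^ 2) := by
    simp only [hgauss, max_eq_right (Nat.le_self_pow two_ne_zero d)]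
    exact Finset.sup_const Finset.univ_nonempty _
  calc (memorizing p w m S).width
      = max (max (Fintype.card X + p) K) (max (Fintype.card X + p) (d ^ 2)) :=
        congrArg₂ max (congrArg (max · K) hweight) hsup
    _ = max K (max (d ^ 2) (Fintype.card X + p)) := by lia

theorem par_memorizing_le :
    (memorizing p w m S).par ≤
      Fintype.card X * (2 + K) + K * (Fintype.card X * (2 + (d + d ^ 2))) := by
  have hweight : (memorizing p w m S).weightNet.par ≤ Fintype.card X * (2 + K) :=
    (ReLUNet.par_memorizer_le ..).trans_eq (by rw [Fintype.card_fin]; rfl)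
  have hgauss (k : Fin K) :
      ((memorizing p w m S).gaussNet k).par ≤ Fintype.card X * (2 + (d + d ^ 2)) :=
    (ReLUNet.par_memorizer_le ..).trans_eq (by simp [sq, memorizing])
  have hsum : ∑ k : Fin K, ((memorizing p w m S).gaussNet k).par ≤
      K * (Fintype.card X * (2 + (d + d ^ 2))) := by
    simpa using Finset.sum_le_card_nsmul Finset.univ _ _ fun k _ => hgauss k
  exact add_le_add hweight hsum

end ProbTransformer

theorem probAttention_zero_zero {d K : ℕ} [NeZero K] (m : Fin K → EuclideanSpace ℝ (Fin d)) :
    probAttention 0 m 0 = (K : ℝ≥0∞)⁻¹ • ∑ k, multivariateGaussian (m k) 0 := by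
  have hK : ENNReal.ofReal (K : ℝ)⁻¹ = (K : ℝ≥0∞)⁻¹ := by
    rw [ENNReal.ofReal_inv_of_pos (by exact_mod_cast NeZero.pos K), ENNReal.ofReal_natCast]
  simp [probAttention, softmax, Finset.smul_sum, hK]

theorem one_le_complexityFactor {n : ℕ} (hn : 1 < n) (a : ℝ) : 1 ≤ complexityFactor n a := by
  have hn2 : (2 : ℝ) ≤ n := by exact_mod_cast hn
  have hlog : 1 / 2 ≤ Real.log n :=
    calc (1 : ℝ) / 2 ≤ Real.log 2 := by linarith [Real.log_two_gt_d9]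
      _ ≤ Real.log n := Real.log_le_log two_pos hn2
  have hsqrt : 1 ≤ √(n * Real.log n) := Real.one_le_sqrt.2 (by nlinarith)
  exact one_le_mul_of_one_le_of_one_le hsqrt (le_add_of_nonneg_right (by positivity))

theorem parameterCount_le {n K : ℕ} (hn : 1 < n) (hK : 0 < K) (d : ℕ) {F : ℝ} (hF : 1 ≤ F) :
    ((n * (2 + K) + K * (n * (2 + (d + d ^ 2))) : ℕ) : ℝ) ≤
      2 * (K * n * (11 / 4 * max (n : ℝ) d * (n : ℝ) ^ 2 - 1) * (d + max (d : ℝ) 12 ^ 2 * F)) := by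
  have hn2 : (2 : ℝ) ≤ n := by exact_mod_cast hn
  have hK1 : (1 : ℝ) ≤ K := by exact_mod_cast hK
  have hfac : 1 ≤ 11 / 4 * max (n : ℝ) d * (n : ℝ) ^ 2 - 1 := by
    have hmax : (2 : ℝ) ≤ max (n : ℝ) d := le_max_of_le_left hn2
    nlinarith
  have hd : (d : ℝ) ^ 2 ≤ max (d : ℝ) 12 ^ 2 := by gcongr; exact le_max_left _ _
  have h12 : (12 : ℝ) ^ 2 ≤ max (d : ℝ) 12 ^ 2 := by gcongr; exact le_max_right _ _
  calc ((n * (2 + K) + K * (n * (2 + (d + d ^ 2))) : ℕ) : ℝ)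
      = 2 * n * 1 + K * n * (3 + d + d ^ 2) := by push_cast; ring
    _ ≤ 2 * n * K + K * n * (3 + d + d ^ 2) := by gcongr
    _ = K * n * (5 + d + d ^ 2) := by ring
    _ ≤ K * n * (2 * (d + max (d : ℝ) 12 ^ 2)) := by gcongr; linarith [d.cast_nonneg (α := ℝ)]
    _ = 2 * (K * n * 1 * (d + max (d : ℝ) 12 ^ 2 * 1)) := by ring
    _ ≤ _ := by gcongr

theorem mainTheorem10_general :
    ∃ C : ℝ, 0 < C ∧
      ∀ (n d K : ℕ), 1 < n → 0 < K →
      ∀ (X : Type*) [MetricSpace X] [Fintype X], Fintype.card X = n →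
      ∀ (w : X → Fin K → ℝ) (m : Fin K → X → EuclideanSpace ℝ (Fin d))
        (S : Fin K → X → Matrix (Fin d) (Fin d) ℝ),
        ∃ T : ProbTransformer X d,
          (∀ x : X, T.eval x = probAttention (w x) (fun k => m k x) (fun k => S k x)) ∧
          T.width = max (max n K) (max (d ^ 2) (n * (n - 1) + max d 12)) ∧
          (T.depth : ℝ) ≤ C * (n * (1 + complexityFactor n (aspect X))) ∧
          T.effdim ≤ K * (d + d ^ 2) ∧
          (T.par : ℝ) ≤
            C * (K * n * (11 / 4 * max (n : ℝ) d * (n : ℝ) ^ 2 - 1) *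
              (d + max (d : ℝ) 12 ^ 2 * complexityFactor n (aspect X))) := by
  refine ⟨2, two_pos, fun n d K hn hK X _ _ hX w m S => ?_⟩
  subst hX
  have : Nonempty X := Fintype.card_pos_iff.1 (by lia)
  have : NeZero K := ⟨hK.ne'⟩
  have hF := one_le_complexityFactor hn (aspect X)
  set n := Fintype.card X
  obtain ⟨p, hp⟩ : ∃ p, n * (n - 1) + max d 12 = n + p :=
    Nat.exists_eq_add_of_le (le_add_right (Nat.le_mul_of_pos_right n (Nat.sub_pos_of_lt hn)))
  refine ⟨.memorizing p w m S, ProbTransformer.eval_memorizing p w m S, ?_, ?_, le_rfl, ?_⟩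
  · rw [ProbTransformer.width_memorizing, hp]
    lia
  · have hn1 : (1 : ℝ) ≤ n := by exact_mod_cast hn.le
    rw [ProbTransformer.depth_memorizing]
    push_cast
    nlinarith
  · exact (Nat.cast_le.2 (ProbTransformer.par_memorizing_le p w m S)).trans
      (parameterCount_le hn hK d hF)

theorem mainTheorem10 :
    ∃ C : ℝ, 0 < C ∧
      ∀ (n d K : ℕ), 2 < n → 0 < d → 0 < K →
      ∀ (X : Type*) [MetricSpace X] [Fintype X], Fintype.card X = n →
      ∀ μ : Fin K → X → EuclideanSpace ℝ (Fin d),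
        ∃ T : ProbTransformer X d,
          (∀ x : X, T.eval x = empiricalKernel μ x) ∧
          T.width = max (max n K) (max (d ^ 2) (n * (n - 1) + max d 12)) ∧
          (T.depth : ℝ) ≤ C * (n * (1 + complexityFactor n (aspect X))) ∧
          T.effdim ≤ K * (d + d ^ 2) ∧
          (T.par : ℝ) ≤
            C * (K * n * (11 / 4 * max (n : ℝ) d * (n : ℝ) ^ 2 - 1) *
              (d + max (d : ℝ) 12 ^ 2 * complexityFactor n (aspect X))) := by
  obtain ⟨C, hC, hgeneral⟩ := mainTheorem10_general
  refine ⟨C, hC, fun n d K hn _ hK X _ _ hX μ => ?_⟩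
  have : NeZero K := ⟨hK.ne'⟩
  simp only [empiricalKernel, ← probAttention_zero_zero]
  exact hgeneral n d K (by lia) hK X hX 0 μ 0
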